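/- Let $\mathbf I=[0,1]$ and let $C(\mathbf I)$ be the set of continuous maps $\mathbf I\to\mathbf I$ with the supremum metric $d(f,g)=\sup_{x\in\mathbf I}|f(x)-g(x)|$. A map $f\in C(\mathbf I)$ is transitive if for all non-empty open sets $U,V\subseteq\mathbf I$ there is an integer $n\ge 1$ with $U\cap f^{-n}(V)\neq\emptyset$. Let $T(\mathbf I)\subseteq C(\mathbf I)$ be the set of transitive maps, $\overline{T(\mathbf I)}$ its closure in $C(\mathbf I)$, and let $T^{PL}(\mathbf I)$ and $T^{PM}(\mathbf I)$ be the sets of those transitive maps that are piecewise linear, respectively piecewise monotone (with finitely many pieces), each with the metric inherited from $C(\mathbf I)$. A metric space $(X,d)$ has the strong discrete approximation property (SDAP) if for every continuous $\varepsilon:X\to(0,1)$, every compact metric space $K$ and every continuous $f:K\times\mathbb N\to X$ (with $\mathbb N$ discrete) there is a continuous $g:K\times\mathbb N\to X$ such that $d(f(k,n),g(k,n))<\varepsilon(f(k,n))$ for all $(k,n)\in K\times\mathbb N$ and the family $(g(K\times\{n\}))_{n\in\mathbb N}$ is discrete in $X$, that is, every point of $X$ has a neighbourhood that meets $g(K\times\{n\})$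 for at most one $n$. **Theorem.** The space $\overline{T(\mathbf I)}$ has SDAP. Moreover, $T(\mathbf I)$, $T^{PL}(\mathbf I)$ and $T^{PM}(\mathbf I)$ have SDAP. -/

import Mathlib

universe v

namespace TransitiveMaps

/-- An indexed family of subsets of a topological space is discrete if every point of the space has
a neighbourhood that meets the member of the family for at most one index. -/
def IsDiscreteFamily {X : Type*} [TopologicalSpace X] {ι : Type*} (A : ι → Set X) : Prop :=
  ∀ x : X, ∃ U ∈ nhds x, {i : ι | (A i ∩ U).Nonempty}.Subsingleton

/-- The strong discrete approximation property of a metric space. -/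
def HasSDAP (X : Type*) [MetricSpace X] : Prop :=
  ∀ (ε : X → ℝ), Continuous ε → (∀ x, ε x ∈ Set.Ioo (0 : ℝ) 1) →
  ∀ (K : Type v) [MetricSpace K] [CompactSpace K] (f : K × ℕ → X), Continuous f →
    ∃ g : K × ℕ → X, Continuous g ∧
      IsDiscreteFamily (fun n : ℕ => g '' (Set.univ ×ˢ {n})) ∧
      ∀ (k : K) (n : ℕ), dist (f (k, n)) (g (k, n)) < ε (f (k, n))

/-- The space of continuous self-maps of `[0,1]`; Mathlib's metric on it is the supremum metric. -/
abbrev SelfMaps : Type := C(unitInterval, unitInterval)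

/-- Topological transitivity: for all non-empty open `U`, `V` there is a positive integer `n` such
that `U` meets the preimage of `V` under the `n`-th iterate of `f`. -/
def IsTransitiveMap (f : SelfMaps) : Prop :=
  ∀ U V : Set unitInterval, IsOpen U → IsOpen V → U.Nonempty → V.Nonempty →
    ∃ n : ℕ, 0 < n ∧ (U ∩ (f^[n]) ⁻¹' V).Nonempty

/-- There is a subdivision of `[0,1]` into finitely many closed intervals, on each of which `f` is
affine. -/
def IsPiecewiseLinear (f : SelfMaps) : Prop :=
  ∃ (m : ℕ) (a : ℕ → unitInterval), Monotone a ∧ a 0 = 0 ∧ a m = 1 ∧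
    ∀ i < m, ∃ c d : ℝ, ∀ x ∈ Set.Icc (a i) (a (i + 1)), (f x : ℝ) = c * (x : ℝ) + d

/-- There is a subdivision of `[0,1]` into finitely many closed intervals, on each of which `f` is
monotone (non-decreasing or non-increasing). -/
def IsPiecewiseMonotone (f : SelfMaps) : Prop :=
  ∃ (m : ℕ) (a : ℕ → unitInterval), Monotone a ∧ a 0 = 0 ∧ a m = 1 ∧
    ∀ i < m, MonotoneOn f (Set.Icc (a i) (a (i + 1))) ∨ AntitoneOn f (Set.Icc (a i) (a (i + 1)))

/-- `T(I)`. -/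
def transitiveMaps : Set SelfMaps := {f | IsTransitiveMap f}

/-- `T^{PL}(I)`. -/
def transitivePL : Set SelfMaps := {f | IsTransitiveMap f ∧ IsPiecewiseLinear f}

/-- `T^{PM}(I)`. -/
def transitivePM : Set SelfMaps := {f | IsTransitiveMap f ∧ IsPiecewiseMonotone f}

end TransitiveMaps

namespace TransitiveMaps

open Set Filter Topology

/-! All four spaces lie between `transitivePL` and `closure transitiveMaps`, so
`hasSDAP_of_transitivePL_subset` covers them at once.

Given `f` in the closure and small `e`, let `G` be the zigzag on a fine uniform grid taking
alternately the values `f + e/2` and `f - e/2`, clamped to `[0,1]`. It is piecewise linear,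
`e`-close to `f` and steep, and the image of each cell contains every cell passing close to the
image of that cell under `f`. Steepness makes intervals grow until some iterate contains a cell;
following an orbit of a transitive map near `f` then leads from any cell to any other. Hence `G` is
transitive, and it depends continuously on `f` and `e`.

For discreteness, grids are chosen successively: the `n`-th family oscillates by at least `ε/2` on a
scale where all earlier families oscillate by less. This makes the images disjoint, and uniform
continuity of a would-be limit rules out accumulation (`isDiscreteFamily_of_oscillation`). -/

/-! ### Piecewise linear maps on a uniform grid -/

/-- The hat function. -/
noncomputable def hat (t : ℝ) : ℝ := max 0 (1 - |t|)

lemma continuous_hat : Continuous hat := by unfold hat; fun_prop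

/-- The piecewise linear function with value `v j` at `j / M` for `j ≤ M`. -/
noncomputable def gridInterp (M : ℕ) (v : ℕ → ℝ) (x : ℝ) : ℝ :=
  ∑ j ∈ Finset.range (M + 1), v j * hat (M * x - j)

lemma gridInterp_eq {M : ℕ} (v : ℕ → ℝ) {j : ℕ} (hj : j < M) {x : ℝ} (h1 : j ≤ M * x)
    (h2 : M * x ≤ j + 1) : gridInterp M v x = v j + (M * x - j) * (v (j + 1) - v j) := by
  unfold gridInterp
  rw [Finset.sum_eq_add_of_mem j (j + 1) (Finset.mem_range.2 (by omega))
    (Finset.mem_range.2 (by omega)) (by omega)]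
  · have e1 : hat (M * x - j) = 1 - (M * x - j) := by
      rw [hat, abs_of_nonneg (by linarith), max_eq_right (by linarith)]
    have e2 : hat (M * x - (j + 1 : ℕ)) = M * x - j := by
      push_cast
      rw [hat, abs_of_nonpos (by linarith), max_eq_right (by linarith)]
      ring
    rw [e1, e2]
    ring
  · rintro i - ⟨hi1, hi2⟩
    have : hat (M * x - i) = 0 := by
      refine max_eq_left ?_
      rcases lt_or_ge i j with h | h
      · have h' : (i : ℝ) + 1 ≤ j := by exact_mod_cast h
        have := le_abs_self ((M : ℝ) * x - i)
        linarith
      · have h' : (j : ℝ) + 2 ≤ i := by exact_mod_cast (by omega : j + 2 ≤ i)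
        have := neg_abs_le ((M : ℝ) * x - i)
        linarith
    rw [this, mul_zero]

/-- The `j`-th cell of the uniform grid with `M` cells. -/
def cell (M j : ℕ) : Set unitInterval := {x | (j : ℝ) ≤ M * x ∧ (M : ℝ) * x ≤ j + 1}

lemma exists_mem_cell {M : ℕ} (hM : 0 < M) (x : unitInterval) : ∃ j < M, x ∈ cell M j := by
  have hM' : (0 : ℝ) < M := by exact_mod_cast hM
  have hx0 := x.2.1
  have hx1 := x.2.2
  have h0 : (0 : ℝ) ≤ M * x := by positivity
  rcases hx1.lt_or_eq with h | h
  · refine ⟨⌊(M : ℝ) * x⌋₊, ?_, Nat.floor_le h0, (Nat.lt_floor_add_one _).le⟩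
    rw [Nat.floor_lt h0]
    nlinarith
  · refine ⟨M - 1, by omega, ?_, ?_⟩ <;> rw [h, Nat.cast_sub (by omega)] <;> simp

/-- The grid point `j / M`. -/
noncomputable def gridPoint (M j : ℕ) : unitInterval :=
  projIcc 0 1 zero_le_one ((j : ℝ) / M)

lemma coe_gridPoint {M j : ℕ} (h : j ≤ M) : (gridPoint M j : ℝ) = (j : ℝ) / M := by
  have : (j : ℝ) / M ∈ Icc (0 : ℝ) 1 :=
    ⟨by positivity, div_le_one_of_le₀ (by exact_mod_cast h) (by positivity)⟩
  rw [gridPoint, projIcc_of_mem _ this]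

lemma mul_gridPoint {M j : ℕ} (hM : 0 < M) (h : j ≤ M) : (M : ℝ) * gridPoint M j = j := by
  have : (0 : ℝ) < M := by exact_mod_cast hM
  rw [coe_gridPoint h]
  field_simp

lemma cell_eq_Icc {M j : ℕ} (h : j < M) :
    cell M j = Icc (gridPoint M j) (gridPoint M (j + 1)) := by
  have hM : (0 : ℝ) < M := by exact_mod_cast (by omega : 0 < M)
  ext x
  rw [mem_Icc, ← Subtype.coe_le_coe, ← Subtype.coe_le_coe, coe_gridPoint h.le,
    coe_gridPoint (Nat.succ_le_of_lt h), div_le_iff₀' hM, le_div_iff₀' hM]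
  simp [cell]

lemma gridPoint_le {M j : ℕ} (h : j < M) : gridPoint M j ≤ gridPoint M (j + 1) := by
  rw [← Subtype.coe_le_coe, coe_gridPoint h.le, coe_gridPoint (Nat.succ_le_of_lt h)]
  gcongr
  simp

/-- `G` is the piecewise linear self-map with value `v j` at `j / M` for `j ≤ M`. -/
def IsGridAffine (M : ℕ) (v : ℕ → ℝ) (G : SelfMaps) : Prop :=
  ∀ j < M, ∀ x ∈ cell M j, (G x : ℝ) = v j + (M * x - j) * (v (j + 1) - v j)

lemma IsGridAffine.left {M : ℕ} {v : ℕ → ℝ} {G : SelfMaps} (hG : IsGridAffine M v G) {j : ℕ}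
    (h : j < M) : (G (gridPoint M j) : ℝ) = v j := by
  rw [hG j h _ (by rw [cell_eq_Icc h]; exact ⟨le_rfl, gridPoint_le h⟩),
    mul_gridPoint (by omega) h.le]
  ring

lemma IsGridAffine.right {M : ℕ} {v : ℕ → ℝ} {G : SelfMaps} (hG : IsGridAffine M v G) {j : ℕ}
    (h : j < M) : (G (gridPoint M (j + 1)) : ℝ) = v (j + 1) := by
  rw [hG j h _ (by rw [cell_eq_Icc h]; exact ⟨gridPoint_le h, le_rfl⟩),
    mul_gridPoint (by omega) (Nat.succ_le_of_lt h)]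
  push_cast
  ring

lemma IsGridAffine.isPiecewiseLinear {M : ℕ} {v : ℕ → ℝ} {G : SelfMaps} (hM : 0 < M)
    (hG : IsGridAffine M v G) : IsPiecewiseLinear G := by
  refine ⟨M, gridPoint M, ?_, ?_, ?_, ?_⟩
  · intro i j hij
    exact monotone_projIcc _ (by gcongr)
  · simp [gridPoint]
  · have : (M : ℝ) ≠ 0 := by exact_mod_cast hM.ne'
    simp [gridPoint, this]
  · intro j hj
    refine ⟨M * (v (j + 1) - v j), v j - j * (v (j + 1) - v j), fun x hx => ?_⟩
    rw [← cell_eq_Icc hj] at hx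
    rw [hG j hj x hx]
    ring

lemma uIcc_image_subset (G : SelfMaps) (a b : unitInterval) :
    uIcc (G a) (G b) ⊆ G '' uIcc a b :=
  (isPreconnected_uIcc.image G G.continuous.continuousOn).ordConnected.uIcc_subset
    ⟨a, by simp, rfl⟩ ⟨b, by simp, rfl⟩

/-! ### Steep grid maps are transitive when their cells are connected -/

section Steep

variable {M : ℕ} {v : ℕ → ℝ} {G : SelfMaps}

lemma IsGridAffine.expand_in_cell (hG : IsGridAffine M v G)
    (hs : ∀ j < M, 4 ≤ M * |v (j + 1) - v j|) {j : ℕ} (hj : j < M) {a b : unitInterval}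
    (hab : a ≤ b) (ha : a ∈ cell M j) (hb : b ∈ cell M j) :
    ∃ a' b' : unitInterval, 4 * ((b : ℝ) - a) ≤ b' - a' ∧ Icc a' b' ⊆ G '' Icc a b := by
  refine ⟨G a ⊓ G b, G a ⊔ G b, ?_, ?_⟩
  · have h0 : (0 : ℝ) ≤ b - a := sub_nonneg.2 hab
    have key : 4 * ((b : ℝ) - a) ≤ |(G b : ℝ) - G a| := by
      have : (G b : ℝ) - G a = (b - a) * (M * (v (j + 1) - v j)) := by
        rw [hG j hj a ha, hG j hj b hb]
        ring
      rw [this, abs_mul, abs_of_nonneg h0, abs_mul, Nat.abs_cast, mul_comm]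
      exact mul_le_mul_of_nonneg_left (hs j hj) h0
    rcases le_total (G a) (G b) with h | h
    · rw [sup_eq_right.2 h, inf_eq_left.2 h]
      rwa [abs_of_nonneg (sub_nonneg.2 (Subtype.coe_le_coe.2 h))] at key
    · rw [sup_eq_left.2 h, inf_eq_right.2 h]
      rwa [abs_sub_comm, abs_of_nonneg (sub_nonneg.2 (Subtype.coe_le_coe.2 h))] at key
  · have := uIcc_image_subset G a b
    rwa [uIcc_of_le hab] at this

/-- An interval containing no cell meets at most two adjacent cells in more than a point. One of its
pieces has at least half the length, and slope 4 there leaves a factor 2. -/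
lemma IsGridAffine.expand (hM : 0 < M) (hG : IsGridAffine M v G)
    (hs : ∀ j < M, 4 ≤ M * |v (j + 1) - v j|) {a b : unitInterval} (hab : a ≤ b) :
    (∃ j < M, cell M j ⊆ Icc a b) ∨
      ∃ a' b' : unitInterval, 2 * ((b : ℝ) - a) ≤ b' - a' ∧ Icc a' b' ⊆ G '' Icc a b := by
  have hab' : (a : ℝ) ≤ b := hab
  obtain ⟨j, hj, ha⟩ := exists_mem_cell hM a
  by_cases hb : (M : ℝ) * b ≤ j + 1
  · have hM' : (0 : ℝ) < M := by exact_mod_cast hM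
    obtain ⟨a', b', h1, h2⟩ := hG.expand_in_cell hs hj hab ha ⟨ha.1.trans (by gcongr), hb⟩
    exact Or.inr ⟨a', b', by linarith, h2⟩
  push Not at hb
  have hM' : (0 : ℝ) < M := by exact_mod_cast hM
  have hj1 : j + 1 < M := by
    have : (M : ℝ) * b ≤ M := by nlinarith [b.2.2]
    exact_mod_cast hb.trans_le this
  set q := gridPoint M (j + 1) with hq
  have hMq : (M : ℝ) * q = j + 1 := by
    rw [mul_gridPoint hM hj1.le]
    push_cast
    rfl
  have haq : a ≤ q := by
    have := ha.2
    rw [← hMq] at this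
    exact Subtype.coe_le_coe.1 (le_of_mul_le_mul_left this hM')
  have hqb : q ≤ b := by
    rw [← hMq] at hb
    exact Subtype.coe_le_coe.1 (le_of_mul_le_mul_left hb.le hM')
  by_cases hb2 : (M : ℝ) * b ≤ j + 2
  · rcases le_total ((b : ℝ) - a) (2 * (q - a)) with h | h
    · obtain ⟨a', b', h1, h2⟩ :=
        hG.expand_in_cell hs hj haq ha ⟨by rw [hMq]; linarith, hMq.le⟩
      exact Or.inr ⟨a', b', by linarith, h2.trans (image_mono (Icc_subset_Icc_right hqb))⟩
    · obtain ⟨a', b', h1, h2⟩ :=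
        hG.expand_in_cell hs hj1 hqb ⟨by rw [hMq]; simp, by rw [hMq]; push_cast; linarith⟩
          ⟨by push_cast; linarith, by push_cast; linarith⟩
      exact Or.inr ⟨a', b', by linarith, h2.trans (image_mono (Icc_subset_Icc_left haq))⟩
  · push Not at hb2
    refine Or.inl ⟨j + 1, hj1, ?_⟩
    rw [cell_eq_Icc hj1]
    refine Icc_subset_Icc haq ?_
    refine le_of_mul_le_mul_left (a := (M : ℝ)) ?_ hM'
    rw [mul_gridPoint hM (Nat.succ_le_of_lt hj1)]
    push_cast
    linarith

lemma IsGridAffine.exists_cell_subset_image (hM : 0 < M) (hG : IsGridAffine M v G)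
    (hs : ∀ j < M, 4 ≤ M * |v (j + 1) - v j|) (n : ℕ) (a b : unitInterval)
    (hab : (1 / 2 : ℝ) ^ n < b - a) : ∃ m, ∃ j < M, cell M j ⊆ G^[m] '' Icc a b := by
  induction n generalizing a b with
  | zero =>
    -- Length greater than 1 is impossible, so the doubling must already have stopped.
    have := a.2.1
    have := b.2.2
    rw [pow_zero] at hab
    linarith
  | succ n ih =>
    have h0 : (0 : ℝ) < (1 / 2) ^ (n + 1) := by positivity
    rcases hG.expand hM hs (a := a) (b := b) (by rw [← Subtype.coe_le_coe]; linarith) with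
      ⟨j, hj, h⟩ | ⟨a', b', h1, h2⟩
    · exact ⟨0, j, hj, by simpa using h⟩
    · obtain ⟨m, j, hj, h⟩ := ih a' b' (by rw [pow_succ] at hab; linarith)
      refine ⟨m + 1, j, hj, h.trans ?_⟩
      rw [Function.iterate_succ, image_comp]
      exact image_mono h2

lemma IsGridAffine.isTransitiveMap (hM : 0 < M) (hG : IsGridAffine M v G)
    (hs : ∀ j < M, 4 ≤ M * |v (j + 1) - v j|)
    (hc : ∀ j < M, ∀ l < M, ∃ m, 0 < m ∧ cell M l ⊆ G^[m] '' cell M j) :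
    IsTransitiveMap G := by
  rintro U V hU - hUne ⟨y, hy⟩
  obtain ⟨a, b, hab, hsub⟩ := hU.exists_Ioo_subset hUne
  obtain ⟨a', ha', hab'⟩ := exists_between hab
  obtain ⟨b', hb', hab''⟩ := exists_between hab'
  obtain ⟨n, hn⟩ := exists_pow_lt_of_lt_one (sub_pos.2 hb' : (0 : ℝ) < b' - a')
    (by norm_num : (1 / 2 : ℝ) < 1)
  obtain ⟨m, j, hj, h⟩ := hG.exists_cell_subset_image hM hs n a' b' hn
  obtain ⟨l, hl, hyl⟩ := exists_mem_cell hM y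
  obtain ⟨m', hm', h'⟩ := hc j hj l hl
  obtain ⟨z, hz, hzy⟩ := h' hyl
  obtain ⟨w, hw, hwz⟩ := h hz
  refine ⟨m' + m, by omega, w, hsub ⟨ha'.trans_le hw.1, hw.2.trans_lt hab''⟩, ?_⟩
  rw [mem_preimage, Function.iterate_add_apply, hwz, hzy]
  exact hy

end Steep

/-! ### Zigzags around a map -/

/-- The point `F + s * e / 2` moved into `[0,1]`. -/
noncomputable def clampShift (F e s : ℝ) : ℝ := max 0 (min 1 (F + s * e / 2))

lemma clampShift_mem (F e s : ℝ) : clampShift F e s ∈ Icc (0 : ℝ) 1 :=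
  ⟨le_max_left _ _, max_le zero_le_one (min_le_left _ _)⟩

lemma abs_clampShift_sub {F e s : ℝ} (hF : F ∈ Icc (0 : ℝ) 1) (he : 0 < e)
    (hs : s = 1 ∨ s = -1) : |clampShift F e s - F| ≤ e / 2 := by
  obtain ⟨h0, h1⟩ := hF
  unfold clampShift
  rcases hs with rfl | rfl <;> rw [abs_le] <;> grind

/-- Unclamped, the gap exceeds `7e/8`. If just one value is clamped, the other still lies `e/2`
inside `[0,1]`; if both are, the gap is 1. -/
lemma abs_clampShift_sub_ge {F F' e s : ℝ} (hF : F ∈ Icc (0 : ℝ) 1) (hF' : F' ∈ Icc (0 : ℝ) 1)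
    (he : 0 < e) (he1 : e < 1) (hs : s = 1 ∨ s = -1) (h : |F - F'| < e / 8) :
    e / 2 ≤ |clampShift F' e (-s) - clampShift F e s| := by
  obtain ⟨h0, h1⟩ := hF
  obtain ⟨h0', h1'⟩ := hF'
  rw [abs_lt] at h
  obtain ⟨h2, h3⟩ := h
  unfold clampShift
  rcases hs with rfl | rfl <;> rw [le_abs]
  · right; grind
  · left; grind

lemma mem_uIcc_clampShift {F F' e s y : ℝ} (hy : y ∈ Icc (0 : ℝ) 1)
    (hs : s = 1 ∨ s = -1) (h : |y - F| ≤ e / 2) (h' : |y - F'| ≤ e / 2) :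
    y ∈ uIcc (clampShift F e s) (clampShift F' e (-s)) := by
  obtain ⟨h0, h1⟩ := hy
  rw [abs_le] at h h'
  obtain ⟨h2, h3⟩ := h
  obtain ⟨h4, h5⟩ := h'
  rw [mem_uIcc]
  unfold clampShift
  rcases hs with rfl | rfl
  · right; constructor <;> grind
  · left; constructor <;> grind

/-- The values at the grid points of the zigzag of height `e` around `f`. -/
noncomputable def zigzagValue (f : SelfMaps) (e : ℝ) (M j : ℕ) : ℝ :=
  clampShift (f (gridPoint M j)) e ((-1) ^ j)

lemma dist_le_of_mem_cell {M j : ℕ} (hM : 0 < M) {x y : unitInterval} (hx : x ∈ cell M j)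
    (hy : y ∈ cell M j) : dist x y ≤ 1 / M := by
  have hM' : (0 : ℝ) < M := by exact_mod_cast hM
  obtain ⟨h1, h2⟩ := hx
  obtain ⟨h3, h4⟩ := hy
  rw [Subtype.dist_eq, Real.dist_eq, le_div_iff₀ hM', ← abs_of_pos hM', ← abs_mul, abs_le]
  constructor <;> nlinarith [abs_of_pos hM']

lemma left_mem_cell {M j : ℕ} (h : j < M) : gridPoint M j ∈ cell M j := by
  rw [cell_eq_Icc h]
  exact ⟨le_rfl, gridPoint_le h⟩

lemma right_mem_cell {M j : ℕ} (h : j < M) : gridPoint M (j + 1) ∈ cell M j := by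
  rw [cell_eq_Icc h]
  exact ⟨gridPoint_le h, le_rfl⟩

section Zigzag

variable {M : ℕ} {f G : SelfMaps} {e : ℝ}

/-- Three errors of `e/8` keep all of cell `l` within `e/2` of `f` at both ends of cell `j`, hence
between the two end values of `G`. -/
lemma zigzag_cell_subset (hM : 0 < M) (hMe : 1 / (M : ℝ) ≤ e / 8)
    (hosc : ∀ x y, dist x y ≤ 1 / (M : ℝ) → dist (f x) (f y) < e / 8)
    (hG : IsGridAffine M (zigzagValue f e M) G) {j l : ℕ} (hj : j < M)
    {z w : unitInterval} (hz : z ∈ cell M j) (hw : w ∈ cell M l) (hzw : dist w (f z) < e / 8) :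
    cell M l ⊆ G '' cell M j := by
  intro y hy
  have hyw := (dist_le_of_mem_cell hM hy hw).trans hMe
  have hclose : ∀ p ∈ cell M j, |(y : ℝ) - f p| ≤ e / 2 := by
    intro p hp
    have h1 := hosc z p (dist_le_of_mem_cell hM hz hp)
    have h2 : dist y (f p) ≤ dist y w + dist w (f z) + dist (f z) (f p) := dist_triangle4 _ _ _ _
    rw [← Real.dist_eq, ← Subtype.dist_eq]
    have := dist_nonneg (x := y) (y := w)
    linarith
  have hmem : y ∈ uIcc (G (gridPoint M j)) (G (gridPoint M (j + 1))) := by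
    have := mem_uIcc_clampShift y.2 (neg_one_pow_eq_or ℝ j) (hclose _ (left_mem_cell hj))
      (hclose _ (right_mem_cell hj))
    have e1 := hG.left hj
    have e2 := hG.right hj
    rw [zigzagValue] at e1 e2
    rw [pow_succ, mul_neg_one] at e2
    rw [← e1, ← e2, mem_uIcc] at this
    rw [mem_uIcc]
    exact this
  rw [cell_eq_Icc hj, ← uIcc_of_le (gridPoint_le hj)]
  exact uIcc_image_subset _ _ _ hmem

lemma zigzag_cell_connected (hf : f ∈ closure transitiveMaps) (he : 0 < e) (hM : 0 < M)
    (hMe : 1 / (M : ℝ) ≤ e / 8)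
    (hosc : ∀ x y, dist x y ≤ 1 / (M : ℝ) → dist (f x) (f y) < e / 8)
    (hG : IsGridAffine M (zigzagValue f e M) G) {j l : ℕ} (hj : j < M) (hl : l < M) :
    ∃ m, 0 < m ∧ cell M l ⊆ G^[m] '' cell M j := by
  obtain ⟨f', hf', hd⟩ := Metric.mem_closure_iff.1 hf (e / 8) (by positivity)
  have hMp : (0 : ℝ) < M := by exact_mod_cast hM
  have hint : ∀ i < M, ∃ a b : unitInterval, a < b ∧ Ioo a b ⊆ cell M i := fun i hi => by
    refine ⟨gridPoint M i, gridPoint M (i + 1), ?_, ?_⟩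
    · rw [← Subtype.coe_lt_coe, coe_gridPoint hi.le, coe_gridPoint (Nat.succ_le_of_lt hi)]
      gcongr
      simp
    · rw [cell_eq_Icc hi]
      exact Ioo_subset_Icc_self
  obtain ⟨a, b, hab, hsub⟩ := hint j hj
  obtain ⟨a', b', hab', hsub'⟩ := hint l hl
  obtain ⟨n, hn, u, hu, hun⟩ := hf' (Ioo a b) (Ioo a' b') isOpen_Ioo isOpen_Ioo
    (nonempty_Ioo.2 hab) (nonempty_Ioo.2 hab')
  -- The orbit of `u` under `f'` is an `e/8`-pseudo-orbit of `f`; the cells it visits form a chain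
  -- of coverings for `G`.
  have step : ∀ n, 0 < n → ∀ l < M, f'^[n] u ∈ cell M l → cell M l ⊆ G^[n] '' cell M j := by
    intro n hn
    induction n, hn using Nat.le_induction with
    | base =>
      intro l hl hw
      exact zigzag_cell_subset hM hMe hosc hG hj (hsub hu) hw
        (by rw [dist_comm]; exact (ContinuousMap.dist_lt_iff (by positivity)).1 hd u)
    | succ n hn ih =>
      intro l hl hw
      obtain ⟨i, hi, hui⟩ := exists_mem_cell hM (f'^[n] u)
      rw [Function.iterate_succ', image_comp]
      rw [Function.iterate_succ_apply'] at hw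
      exact (zigzag_cell_subset hM hMe hosc hG hi hui hw
        (by rw [dist_comm]; exact (ContinuousMap.dist_lt_iff (by positivity)).1 hd _)).trans
        (image_mono (ih i hi hui))
  exact ⟨n, hn, step n hn l hl (hsub' hun)⟩

lemma zigzag_oscillation (he : 0 < e) (he1 : e < 1) (hM : 0 < M)
    (hosc : ∀ x y, dist x y ≤ 1 / (M : ℝ) → dist (f x) (f y) < e / 8) {j : ℕ} (hj : j < M) :
    e / 2 ≤ |zigzagValue f e M (j + 1) - zigzagValue f e M j| := by
  rw [zigzagValue, zigzagValue, pow_succ, mul_neg_one]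
  refine abs_clampShift_sub_ge (f _).2 (f _).2 he he1 (neg_one_pow_eq_or ℝ j) ?_
  rw [← Real.dist_eq, ← Subtype.dist_eq]
  exact hosc _ _ (dist_le_of_mem_cell hM (left_mem_cell hj) (right_mem_cell hj))

lemma zigzag_mem_transitivePL (hf : f ∈ closure transitiveMaps) (he : 0 < e) (he1 : e < 1)
    (hM : 0 < M) (hMe : 1 / (M : ℝ) ≤ e / 8)
    (hosc : ∀ x y, dist x y ≤ 1 / (M : ℝ) → dist (f x) (f y) < e / 8)
    (hG : IsGridAffine M (zigzagValue f e M) G) : G ∈ transitivePL := by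
  refine ⟨hG.isTransitiveMap hM (fun j hj => ?_)
    (fun j hj l hl => zigzag_cell_connected hf he hM hMe hosc hG hj hl), hG.isPiecewiseLinear hM⟩
  -- The slope is at least `M * e / 2`, and `M * e ≥ 8`.
  have hMp : (0 : ℝ) < M := by exact_mod_cast hM
  rw [div_le_iff₀ hMp] at hMe
  have := mul_le_mul_of_nonneg_left (zigzag_oscillation he he1 hM hosc hj) hMp.le
  linarith

lemma zigzag_dist_lt (he : 0 < e) (hM : 0 < M)
    (hosc : ∀ x y, dist x y ≤ 1 / (M : ℝ) → dist (f x) (f y) < e / 8)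
    (hG : IsGridAffine M (zigzagValue f e M) G) : dist f G < e := by
  rw [ContinuousMap.dist_lt_iff he]
  intro x
  obtain ⟨j, hj, hx⟩ := exists_mem_cell hM x
  have key : ∀ i, gridPoint M i ∈ cell M j → |zigzagValue f e M i - f x| ≤ 5 * e / 8 := by
    intro i hi
    have h1 := hosc _ _ (dist_le_of_mem_cell hM hi hx)
    rw [Subtype.dist_eq, Real.dist_eq] at h1
    have h2 := abs_clampShift_sub (f (gridPoint M i)).2 he (neg_one_pow_eq_or ℝ i)
    have h3 := abs_sub_le (zigzagValue f e M i) (f (gridPoint M i)) (f x)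
    rw [zigzagValue] at h3 ⊢
    linarith
  have h1 := abs_le.1 (key j (left_mem_cell hj))
  have h2 := abs_le.1 (key (j + 1) (right_mem_cell hj))
  rw [Subtype.dist_eq, Real.dist_eq, hG j hj x hx, abs_lt]
  obtain ⟨h3, h4⟩ := hx
  constructor <;> nlinarith

end Zigzag

/-! ### Families of zigzags -/

lemma gridInterp_mem {M : ℕ} {v : ℕ → ℝ} (hM : 0 < M) (hv : ∀ j, v j ∈ Icc (0 : ℝ) 1)
    (x : unitInterval) : gridInterp M v x ∈ Icc (0 : ℝ) 1 := by
  obtain ⟨j, hj, h1, h2⟩ := exists_mem_cell hM x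
  rw [gridInterp_eq v hj h1 h2]
  obtain ⟨h3, h4⟩ := hv j
  obtain ⟨h5, h6⟩ := hv (j + 1)
  constructor <;> nlinarith

/-- Writing the interpolation as a sum of hats gives joint continuity in `(k, x)`; currying turns it
into continuity for the supremum metric. -/
lemma exists_continuous_zigzag {K : Type*} [TopologicalSpace K] (f : C(K, SelfMaps)) {e : K → ℝ}
    (he : Continuous e) {M : ℕ} (hM : 0 < M) :
    ∃ g : C(K, SelfMaps), ∀ k, IsGridAffine M (zigzagValue (f k) (e k) M) (g k) := by
  have hval : ∀ j, Continuous fun k => zigzagValue (f k) (e k) M j := by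
    intro j
    unfold zigzagValue clampShift
    have : Continuous fun k => f k (gridPoint M j) :=
      (ContinuousEvalConst.continuous_eval_const _).comp f.continuous
    fun_prop
  have hcont : Continuous fun p : K × unitInterval =>
      gridInterp M (zigzagValue (f p.1) (e p.1) M) p.2 := by
    unfold gridInterp
    refine continuous_finsetSum _ fun j _ => ?_
    exact ((hval j).comp continuous_fst).mul (continuous_hat.comp (by fun_prop))
  refine ⟨ContinuousMap.curry ⟨fun p => ⟨gridInterp M (zigzagValue (f p.1) (e p.1) M) p.2,
    gridInterp_mem hM (fun j => clampShift_mem _ _ _) _⟩, hcont.subtype_mk _⟩, ?_⟩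
  intro k j hj x hx
  exact gridInterp_eq _ hj hx.1 hx.2

lemma eventually_dist_lt {K : Type*} [MetricSpace K] [CompactSpace K] (f : C(K, SelfMaps))
    {η : ℝ} (hη : 0 < η) :
    ∀ᶠ δ in 𝓝[>] (0 : ℝ), ∀ k x y, dist x y ≤ δ → dist (f k x) (f k y) < η := by
  have huc : UniformContinuous fun p : K × unitInterval => f p.1 p.2 :=
    CompactSpace.uniformContinuous_of_continuous
      (ContinuousMap.continuous_uncurry_of_continuous f)
  obtain ⟨δ, hδ, h⟩ := Metric.uniformContinuous_iff.1 huc η hη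
  filter_upwards [Ioo_mem_nhdsGT hδ] with δ' hδ' k x y hxy
  refine @h (k, x) (k, y) ?_
  rw [Prod.dist_eq, dist_self]
  exact max_lt hδ (hxy.trans_lt hδ'.2)

lemma exists_pos_forall_le {K : Type*} [TopologicalSpace K] [CompactSpace K] {e : K → ℝ}
    (he : Continuous e) (h0 : ∀ k, 0 < e k) : ∃ c, 0 < c ∧ ∀ k, c ≤ e k := by
  obtain ⟨c, hc, h⟩ := isCompact_univ.exists_forall_le' he.continuousOn (fun k _ => h0 k)
  exact ⟨c, hc, fun k => h k (mem_univ k)⟩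

/-- A compact family in the closure of the transitive maps can be approximated by a family of
transitive piecewise linear maps which oscillate on arbitrarily small scales by an amount
comparable to the distance allowed. -/
lemma exists_oscillating_approx {K : Type*} [MetricSpace K] [CompactSpace K]
    (f : C(K, SelfMaps)) (hf : ∀ k, f k ∈ closure transitiveMaps) {e : K → ℝ} (he : Continuous e)
    (h0 : ∀ k, 0 < e k) (h1 : ∀ k, e k < 1) {δ : ℝ} (hδ : 0 < δ) :
    ∃ g : C(K, SelfMaps), ∀ k, g k ∈ transitivePL ∧ dist (f k) (g k) < e k ∧
      ∃ x y, dist x y ≤ δ ∧ e k / 2 ≤ dist (g k x) (g k y) := by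
  obtain ⟨c, hc, hce⟩ := exists_pos_forall_le he h0
  -- Compactness of `K` allows one mesh for all `k`.
  have hev := (eventually_dist_lt f (η := c / 8) (by positivity)).and
    (Ioc_mem_nhdsGT (lt_min hδ (by positivity : 0 < c / 8)))
  have hlim : Tendsto (fun n : ℕ => 1 / ((n : ℝ) + 1)) atTop (𝓝[>] 0) :=
    tendsto_nhdsWithin_iff.2 ⟨tendsto_one_div_add_atTop_nhds_zero_nat,
      Eventually.of_forall fun n => by rw [mem_Ioi]; positivity⟩
  obtain ⟨n, hn, hn'⟩ := (hlim.eventually hev).exists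
  have hcast : 1 / ((n : ℝ) + 1) = 1 / ((n + 1 : ℕ) : ℝ) := by push_cast; rfl
  rw [hcast] at hn hn'
  have hM : 0 < n + 1 := n.succ_pos
  obtain ⟨g, hg⟩ := exists_continuous_zigzag f he hM
  refine ⟨g, fun k => ?_⟩
  have hosc : ∀ x y, dist x y ≤ 1 / ((n + 1 : ℕ) : ℝ) → dist (f k x) (f k y) < e k / 8 :=
    fun x y hxy => (hn k x y hxy).trans_le (by linarith [hce k])
  have hMe : 1 / ((n + 1 : ℕ) : ℝ) ≤ e k / 8 := by
    have := hn'.2.trans (min_le_right _ _)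
    linarith [hce k]
  refine ⟨zigzag_mem_transitivePL (hf k) (h0 k) (h1 k) hM hMe hosc (hg k),
    zigzag_dist_lt (h0 k) hM hosc (hg k), gridPoint (n + 1) (0 + 1), gridPoint (n + 1) 0, ?_, ?_⟩
  · exact (dist_le_of_mem_cell hM (right_mem_cell hM) (left_mem_cell hM)).trans
      (hn'.2.trans (min_le_left _ _))
  · rw [Subtype.dist_eq, Real.dist_eq, (hg k).right hM, (hg k).left hM]
    exact zigzag_oscillation (h0 k) (h1 k) hM hosc hM

/-! ### The strong discrete approximation property -/

lemma exists_seq_of_forall_prev {α : Type*} (P : ∀ n : ℕ, (∀ m < n, α) → α → Prop)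
    (h : ∀ n p, ∃ a, P n p a) : ∃ s : ℕ → α, ∀ n, P n (fun m _ => s m) (s n) := by
  choose F hF using h
  refine ⟨fun n => (Nat.lt_wfRel.wf).fix F n, fun n => ?_⟩
  beta_reduce
  rw [(Nat.lt_wfRel.wf).fix_eq F n]
  exact hF n _

/-- Families of self-maps which oscillate at smaller and smaller scales, by an amount bounded below
in terms of the distance to given families, form a discrete family of sets. -/
lemma isDiscreteFamily_of_oscillation {S : Set SelfMaps} {ε : S → ℝ} (hε : Continuous ε)
    (h0 : ∀ z, 0 < ε z) {K : Type*} [TopologicalSpace K] [CompactSpace K] (f g : ℕ → K → S)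
    (hg : ∀ n, Continuous (g n)) (hfg : ∀ n k, dist (f n k) (g n k) < ε (f n k))
    (hosc : ∀ n : ℕ, ∃ δ, δ ≤ 1 / ((n : ℝ) + 1) ∧
      (∀ k, ∃ x y, dist x y ≤ δ ∧
        ε (f n k) / 2 ≤ dist ((g n k : SelfMaps) x) ((g n k : SelfMaps) y)) ∧
      ∀ m < n, ∀ k k' x y, dist x y ≤ δ →
        dist ((g m k' : SelfMaps) x) ((g m k' : SelfMaps) y) < ε (f n k) / 2) :
    IsDiscreteFamily fun n => range (g n) := by
  intro h
  obtain ⟨r, hr, N, hN⟩ : ∃ r > 0, ∃ N : ℕ, ∀ n ≥ N, ∀ k, r ≤ dist (g n k) h := by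
    obtain ⟨ρ, hρ, hc⟩ := Metric.eventually_nhds_iff.1
      (hε.continuousAt.eventually_const_lt (half_lt_self (h0 h)))
    set c := min (ε h / 2) (ρ / 2)
    have hcpos : 0 < c := lt_min (half_pos (h0 h)) (half_pos hρ)
    have huc : UniformContinuous (h : SelfMaps) :=
      CompactSpace.uniformContinuous_of_continuous (h : SelfMaps).continuous
    obtain ⟨δ, hδ, hδh⟩ := Metric.uniformContinuous_iff.1 huc (c / 4) (by positivity)
    obtain ⟨N, hN⟩ := exists_nat_one_div_lt hδ
    refine ⟨c / 8, by positivity, N, fun n hn k => ?_⟩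
    by_contra! hlt
    -- Otherwise `f n k` would be within `ρ` of `h`, where `ε` exceeds `ε h / 2`. So `g n k`
    -- oscillates by at least `c / 2`, but `h` by less than `c / 4`, and passing from one to the
    -- other costs less than `2 * (c / 8)`.
    have hce : c ≤ ε (f n k) := by
      by_contra! hlt'
      have h1 := hfg n k
      have h2 := dist_triangle (f n k) (g n k) h
      have h3 : c ≤ ρ / 2 := min_le_right _ _
      have h4 := hc (y := f n k) (by linarith)
      have h5 : c ≤ ε h / 2 := min_le_left _ _
      linarith
    obtain ⟨η, hη, hxy, -⟩ := hosc n
    obtain ⟨x, y, hd, ho⟩ := hxy k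
    have hsmall : dist x y < δ := by
      have : 1 / ((n : ℝ) + 1) ≤ 1 / ((N : ℝ) + 1) := by gcongr
      linarith
    have h1 := hδh hsmall
    have h2 := fun z => (ContinuousMap.dist_apply_le_dist (f := (g n k : SelfMaps)) (g := h) z)
    have h3 := dist_triangle4 ((g n k : SelfMaps) x) ((h : SelfMaps) x) ((h : SelfMaps) y)
      ((g n k : SelfMaps) y)
    have h4 := h2 x
    have h5 := h2 y
    rw [dist_comm] at h5
    rw [Subtype.dist_eq] at hlt
    linarith
  have hdisj : ∀ m n, m < n → h ∈ range (g m) → h ∈ range (g n) → False := by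
    rintro m n hmn ⟨k', hk'⟩ ⟨k, hk⟩
    obtain ⟨δ, -, h1, h2⟩ := hosc n
    obtain ⟨x, y, hd, ho⟩ := h1 k
    have := h2 m hmn k k' x y hd
    rw [hk'] at this
    rw [hk] at ho
    linarith
  -- Near `h` only ranges containing `h` are met: the finitely many early ones are closed, the later
  -- ones stay `r` away. By `hdisj` there is at most one.
  refine ⟨{z | ∀ n, z ∈ range (g n) → h ∈ range (g n)}, ?_, ?_⟩
  · have hsmall : ∀ᶠ z in 𝓝 h, ∀ n ∈ Iio N, z ∈ range (g n) → h ∈ range (g n) := by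
      rw [eventually_all_finite (finite_Iio N)]
      intro n _
      by_cases hn : h ∈ range (g n)
      · exact Eventually.of_forall fun _ _ => hn
      · filter_upwards [(isCompact_range (hg n)).isClosed.isOpen_compl.mem_nhds hn] with z hz hz'
        exact absurd hz' hz
    filter_upwards [hsmall, Metric.ball_mem_nhds h hr] with z hz hzr n hzn
    rcases lt_or_ge n N with hn | hn
    · exact hz n hn hzn
    · obtain ⟨k, rfl⟩ := hzn
      exact absurd hzr (not_lt.2 (hN n hn k))
  · rintro m ⟨z, hzm, hz⟩ n ⟨w, hwn, hw⟩
    rcases lt_trichotomy m n with hmn | hmn | hmn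
    · exact (hdisj m n hmn (hz m hzm) (hw n hwn)).elim
    · exact hmn
    · exact (hdisj n m hmn (hw n hwn) (hz m hzm)).elim

theorem hasSDAP_of_transitivePL_subset {S : Set SelfMaps} (hPL : transitivePL ⊆ S)
    (hcl : S ⊆ closure transitiveMaps) : HasSDAP.{v} S := by
  intro ε hε hε01 K _ _ f hf
  have hfn : ∀ n, Continuous fun k => f (k, n) := continuous_prod_of_discrete_right.1 hf
  let f' : ℕ → C(K, SelfMaps) := fun n => ⟨fun k => f (k, n), (hfn n).subtype_val⟩
  obtain ⟨s, hs⟩ := exists_seq_of_forall_prev (α := C(K, SelfMaps))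
    (fun n p a => (∀ k, a k ∈ transitivePL ∧ dist (f' n k) (a k) < ε (f (k, n))) ∧
      ∃ δ, δ ≤ 1 / ((n : ℝ) + 1) ∧
        (∀ k, ∃ x y, dist x y ≤ δ ∧ ε (f (k, n)) / 2 ≤ dist (a k x) (a k y)) ∧
        ∀ m, ∀ hm : m < n, ∀ k k' x y, dist x y ≤ δ →
          dist (p m hm k' x) (p m hm k' y) < ε (f (k, n)) / 2) (by
    intro n p
    have he : Continuous fun k => ε (f (k, n)) := hε.comp (hfn n)
    obtain ⟨c, hc, hce⟩ := exists_pos_forall_le he fun k => (hε01 _).1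
    -- The earlier families are finitely many and each is uniformly equicontinuous, so one scale `δ`
    -- serves them all.
    have hev : ∀ᶠ δ in 𝓝[>] (0 : ℝ), ∀ i : Fin n, ∀ k' x y, dist x y ≤ δ →
        dist (p i i.2 k' x) (p i i.2 k' y) < c / 2 :=
      eventually_all.2 fun i => eventually_dist_lt _ (half_pos hc)
    obtain ⟨δ, h1, h2, h3⟩ := (hev.and (Ioc_mem_nhdsGT
      (by positivity : (0 : ℝ) < 1 / ((n : ℝ) + 1)))).exists
    obtain ⟨g, hg⟩ := exists_oscillating_approx (f' n) (fun k => hcl (f (k, n)).2) he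
      (fun k => (hε01 _).1) (fun k => (hε01 _).2) h2
    exact ⟨g, fun k => ⟨(hg k).1, (hg k).2.1⟩, δ, h3, fun k => (hg k).2.2,
      fun m hm k k' x y hxy => (h1 ⟨m, hm⟩ k' x y hxy).trans_le (by linarith [hce k])⟩)
  let g : ℕ → K → S := fun n k => ⟨s n k, hPL ((hs n).1 k).1⟩
  have hg : ∀ n, Continuous (g n) := fun n => (s n).continuous.subtype_mk _
  refine ⟨fun q => g q.2 q.1, continuous_prod_of_discrete_right.2 hg, ?_,
    fun k n => ((hs n).1 k).2⟩
  have hrange : (fun n : ℕ => (fun q : K × ℕ => g q.2 q.1) '' (univ ×ˢ {n})) =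
      fun n => range (g n) := by
    ext n z
    simp
  rw [hrange]
  exact isDiscreteFamily_of_oscillation hε (fun z => (hε01 z).1) (fun n k => f (k, n)) g hg
    (fun n k => ((hs n).1 k).2) fun n => (hs n).2

lemma IsPiecewiseLinear.isPiecewiseMonotone {f : SelfMaps} (hf : IsPiecewiseLinear f) :
    IsPiecewiseMonotone f := by
  obtain ⟨m, a, ha, h0, h1, h⟩ := hf
  refine ⟨m, a, ha, h0, h1, fun i hi => ?_⟩
  obtain ⟨c, d, hcd⟩ := h i hi
  rcases le_total 0 c with hc | hc
  · refine Or.inl fun x hx y hy hxy => ?_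
    rw [← Subtype.coe_le_coe, hcd x hx, hcd y hy]
    have := mul_le_mul_of_nonneg_left (Subtype.coe_le_coe.2 hxy) hc
    linarith
  · refine Or.inr fun x hx y hy hxy => ?_
    rw [← Subtype.coe_le_coe, hcd x hx, hcd y hy]
    have := mul_le_mul_of_nonpos_left (Subtype.coe_le_coe.2 hxy) hc
    linarith

end TransitiveMaps

theorem mainTheorem5 :
    TransitiveMaps.HasSDAP.{v} ↥(closure TransitiveMaps.transitiveMaps) ∧
    TransitiveMaps.HasSDAP.{v} ↥TransitiveMaps.transitiveMaps ∧
    TransitiveMaps.HasSDAP.{v} ↥TransitiveMaps.transitivePL ∧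
    TransitiveMaps.HasSDAP.{v} ↥TransitiveMaps.transitivePM :=
  ⟨TransitiveMaps.hasSDAP_of_transitivePL_subset
      (fun _ hf => subset_closure hf.1) subset_rfl,
    TransitiveMaps.hasSDAP_of_transitivePL_subset (fun _ hf => hf.1) subset_closure,
    TransitiveMaps.hasSDAP_of_transitivePL_subset subset_rfl fun _ hf => subset_closure hf.1,
    TransitiveMaps.hasSDAP_of_transitivePL_subset
      (fun _ hf => ⟨hf.1, hf.2.isPiecewiseMonotone⟩) fun _ hf => subset_closure hf.1⟩
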